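/- Let $(\Omega,m)$ be a $\sigma$-finite measure space and $\mathcal H$ a separable complex Hilbert space. A set $\mathcal D\subseteq L^\infty(\Omega)$ is a *determining set* for $L^1(\Omega)$ if $f\in L^1(\Omega)$ and $\int_\Omega fg\,dm=0$ for all $g\in\mathcal D$ imply $f=0$. For $\mathcal E\subseteq L^\infty(\Omega)$, a closed subspace $W\subseteq L^2(\Omega,\mathcal H)$ is *multiplicatively invariant* with respect to $\mathcal E$ if $g\phi\in W$ for all $\phi\in W$, $g\in\mathcal E$. A *range function* $J$ assigns to each $\omega\in\Omega$ a closed subspace $J(\omega)$ of $\mathcal H$; with $P_J(\omega)$ the orthogonal projection of $\mathcal H$ onto $J(\omega)$, it is measurable if $\omega\mapsto\langle P_J(\omega)a,b\rangle$ is measurable for all $a,b\in\mathcal H$. It *corresponds* to $W$ if $W=\{\phi\in L^2(\Omega,\mathcal H):\phi(\omega)\in J(\omega)\text{ for a.e. }\omega\}$. A *range operator* $R$ on $J$ assigns to each $\omega$ a bounded linear operator $R(\omega):J(\omega)\to\mathcal H$; it is measurable if $\omega\mapsto\langle R(\omega)P_J(\omega)a,b\rangle$ is measurable for all $a,b\in\mathcal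 H$. A bounded linear operator $U:W\to L^2(\Omega,\mathcal H)$ is *multiplication preserving* with respect to $\mathcal E$ if $W$ is multiplicatively invariant with respect to $\mathcal E$ and $U(g\phi)=g\,U\phi$ for all $g\in\mathcal E$, $\phi\in W$. **Theorem.** Let $\mathcal D$ be a determining set for $L^1(\Omega)$ and let $W\subseteq L^2(\Omega,\mathcal H)$ be a closed subspace which is multiplicatively invariant with respect to $\mathcal D$. Then there is a measurable range function corresponding to $W$. Let $J$ be any such range function. (a) For every bounded linear operator $U:W\to L^2(\Omega,\mathcal H)$ the following are equivalent: 1. $U$ is multiplication preserving with respect to $\mathcal D$. 2. $U$ is multiplication preserving with respect to $L^\infty(\Omega)$. 3. There is a measurable range operator $R$ on $J$ such that for all $\phi\in W$, $$U\phi(\omega)=R(\omega)(\phi(\omega))\quad\text{for a.e. }\omega\in\Omega.\qquad(*)$$ (b) Conversely, for every measurable range operator $R$ on $J$ with $\operatorname{ess\,sup}_{\omega}\|R(\omega)\|<\infty$ there is a bounded linear operator $U:W\to L^2(\Omega,\mathcal H)$, multiplication preserving with respect to $\mathcal D$, such that $(*)$ holds for all $\phi\in W$. (c) The correspondence is one to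 one when range operators equal a.e. are identified: if bounded linear operators $U,U'$ and measurable range operators $R,R'$ on $J$ are related by $(*)$ respectively, then $U=U'$ if and only if $R(\omega)=R'(\omega)$ for a.e. $\omega$. (d) If a bounded linear operator $U$ and a measurable range operator $R$ on $J$ are related by $(*)$, then $\|U\|=\operatorname{ess\,sup}_{\omega\in\Omega}\|R(\omega)\|$. -/

import Mathlib

open MeasureTheory
open scoped ENNReal

namespace MulInvariant

section

variable {Ω H : Type*} [MeasurableSpace Ω] {μ : Measure Ω}
  [NormedAddCommGroup H] [InnerProductSpace ℂ H]

/-- A set `D ⊆ L^∞(Ω)` is a determining set for `L^1(Ω)` if the only `f ∈ L^1(Ω)` with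
`∫ f g = 0` for all `g ∈ D` is `f = 0`. -/
def IsDetermining (D : Set (Lp ℂ ∞ μ)) : Prop :=
  ∀ f : Lp ℂ 1 μ, (∀ g ∈ D, ∫ ω, f ω * g ω ∂μ = 0) → f = 0

/-- The closed subspace `W ⊆ L²(Ω, H)` is multiplicatively invariant with respect to `D`:
`g φ ∈ W` for all `φ ∈ W` and `g ∈ D`. Here `g • φ` is Mathlib's pointwise product
`L^∞(Ω) × L²(Ω, H) → L²(Ω, H)`. -/
def IsMulInvariant (D : Set (Lp ℂ ∞ μ)) (W : ClosedSubmodule ℂ (Lp H 2 μ)) : Prop :=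
  ∀ φ ∈ W.toSubmodule, ∀ g ∈ D, (g • φ : Lp H 2 μ) ∈ W.toSubmodule

/-- A bounded operator `U : W → L²(Ω, H)` is multiplication preserving with respect to `D`:
`W` is multiplicatively invariant with respect to `D`, and `U (g φ) = g (U φ)` for all
`g ∈ D` and `φ ∈ W`. -/
def IsMulPreserving (D : Set (Lp ℂ ∞ μ)) {W : ClosedSubmodule ℂ (Lp H 2 μ)}
    (U : W.toSubmodule →L[ℂ] Lp H 2 μ) : Prop :=
  ∃ hW : IsMulInvariant D W, ∀ g (hg : g ∈ D) (φ : W.toSubmodule),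
    U ⟨(g • (φ : Lp H 2 μ) : Lp H 2 μ), hW φ φ.2 g hg⟩ = (g • U φ : Lp H 2 μ)

/-- `J` is the range function of `W`: `W = {φ ∈ L²(Ω, H) : φ(ω) ∈ J(ω) for a.e. ω}`. -/
def IsRangeFunctionOf (J : Ω → ClosedSubmodule ℂ H)
    (W : ClosedSubmodule ℂ (Lp H 2 μ)) : Prop :=
  ∀ φ : Lp H 2 μ, φ ∈ W.toSubmodule ↔ ∀ᵐ ω ∂μ, φ ω ∈ (J ω).toSubmodule

/-- A range operator on the range function `J`: a family of bounded operators
`R(ω) : J(ω) → H`. -/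
abbrev RangeOperator (J : Ω → ClosedSubmodule ℂ H) : Type _ :=
  ∀ ω, (J ω).toSubmodule →L[ℂ] H

/-- `U` is given by `R`: for all `φ ∈ W`, `(U φ)(ω) = R(ω) (φ(ω))` for a.e. `ω`
(in particular `φ(ω)` lies in the domain `J(ω)` of `R(ω)` for a.e. `ω`). -/
def IsGivenBy {W : ClosedSubmodule ℂ (Lp H 2 μ)} (U : W.toSubmodule →L[ℂ] Lp H 2 μ)
    {J : Ω → ClosedSubmodule ℂ H} (R : RangeOperator J) : Prop :=
  ∀ φ : W.toSubmodule, ∀ᵐ ω ∂μ,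
    ∃ h : (φ : Lp H 2 μ) ω ∈ (J ω).toSubmodule, U φ ω = R ω ⟨(φ : Lp H 2 μ) ω, h⟩

variable [CompleteSpace H]

/-- A range function `J` is measurable if `ω ↦ ⟨P_J(ω) a, b⟩` is measurable for all `a, b ∈ H`,
where `P_J(ω)` is the orthogonal projection of `H` onto `J(ω)`. -/
def IsMeasurableRangeFunction (J : Ω → ClosedSubmodule ℂ H) : Prop :=
  ∀ a b : H, Measurable fun ω =>
    inner ℂ b ((J ω).toSubmodule.orthogonalProjectionOnto a : H)

/-- A range operator `R` on `J` is measurable if `ω ↦ ⟨R(ω) P_J(ω) a, b⟩` is measurable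
for all `a, b ∈ H`. -/
def IsMeasurableRangeOperator {J : Ω → ClosedSubmodule ℂ H} (R : RangeOperator J) : Prop :=
  ∀ a b : H, Measurable fun ω =>
    inner ℂ b (R ω ((J ω).toSubmodule.orthogonalProjectionOnto a))

end

end MulInvariant

/-!
Extending `U` by zero on `Wᗮ`, and each `R ω` by zero on `(J ω)ᗮ`, reduces everything to von
Neumann's theorem on decomposable operators: an operator `T` on `L²(Ω, H)` which commutes with
multiplication by `L^∞(Ω)` has the form `T φ ω = A ω (φ ω)`, with fibres `A ω` that are unique a.e.
and satisfy `‖T‖ = ess sup ‖A ω‖`. The determining property of `D`, applied to the integrable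
function `⟪T† χ, φ⟫ - ⟪χ, T φ⟫`, shows that commuting with `D` implies commuting with `L^∞(Ω)`;
applied to `⟪χ, φ⟫` with `φ ∈ W` and `χ ⊥ W`, it shows that the projection `P_W` commutes with
`L^∞(Ω)`. The fibres of `P_W` are contractive idempotents, hence orthogonal projections, and their
ranges form the range function.
-/

namespace MulInvariant

open Filter

section OperatorFields

variable {Ω : Type*} [MeasurableSpace Ω] {μ : Measure Ω}

theorem ae_forall_of_isClosed {X : Type*} [TopologicalSpace X] [TopologicalSpace.SeparableSpace X]
    {r : Ω → X → Prop} (hclosed : ∀ ω, IsClosed {x | r ω x}) (h : ∀ x, ∀ᵐ ω ∂μ, r ω x) :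
    ∀ᵐ ω ∂μ, ∀ x, r ω x := by
  obtain ⟨s, hs, hdense⟩ := TopologicalSpace.exists_countable_dense X
  filter_upwards [(ae_ball_iff hs).2 fun x _ => h x] with ω hω x
  exact closure_minimal hω (hclosed ω) (hdense x)

variable {𝕜 E F G : Type*} [RCLike 𝕜] [NormedAddCommGroup E] [NormedSpace 𝕜 E]
  [NormedAddCommGroup F] [NormedSpace 𝕜 F] [NormedAddCommGroup G] [NormedSpace 𝕜 G]

/-- A field of bounded operators `ω ↦ A ω` is strongly measurable if it is so at each vector.
Measurability for the operator norm would be too much: it forces an essentially separable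
range. -/
def IsMeasurableField (A : Ω → E →L[𝕜] F) : Prop :=
  ∀ a, StronglyMeasurable fun ω => A ω a

theorem isMeasurableField_of_denseRange {A : Ω → E →L[𝕜] F} {ι : Type*} {d : ι → E}
    (hd : DenseRange d) (hA : ∀ i, StronglyMeasurable fun ω => A ω (d i)) :
    IsMeasurableField A := fun a => by
  obtain ⟨u, hu, hua⟩ := mem_closure_iff_seq_limit.1 (hd a)
  choose s hs using hu
  refine stronglyMeasurable_of_tendsto atTop (fun k => hA (s k)) (tendsto_pi_nhds.2 fun ω => ?_)
  simp only [hs]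
  exact ((A ω).continuous.tendsto a).comp hua

theorem IsMeasurableField.indicator {A : Ω → E →L[𝕜] F} (hA : IsMeasurableField A) {s : Set Ω}
    (hs : MeasurableSet s) : IsMeasurableField (s.indicator A) := fun a => by
  have : (fun ω => s.indicator A ω a) = s.indicator fun ω => A ω a := by
    ext ω
    by_cases hω : ω ∈ s <;> simp [hω]
  exact this ▸ (hA a).indicator hs

theorem IsMeasurableField.stronglyMeasurable_apply [TopologicalSpace.SeparableSpace E]
    {A : Ω → E →L[𝕜] F} (hA : IsMeasurableField A) {φ : Ω → E} (hφ : StronglyMeasurable φ) :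
    StronglyMeasurable fun ω => A ω (φ ω) := by
  borelize E
  have := UniformSpace.secondCountable_of_separable E
  exact (stronglyMeasurable_uncurry_of_continuous_of_stronglyMeasurable
    (fun ω => (A ω).continuous) hA).comp_measurable (hφ.measurable.prodMk measurable_id)

theorem IsMeasurableField.comp [TopologicalSpace.SeparableSpace F] {B : Ω → F →L[𝕜] G}
    {A : Ω → E →L[𝕜] F} (hB : IsMeasurableField B) (hA : IsMeasurableField A) :
    IsMeasurableField fun ω => (B ω).comp (A ω) :=
  fun a => hB.stronglyMeasurable_apply (hA a)

theorem ae_forall_norm_linearCombination_le [TopologicalSpace.SeparableSpace E] {p : ℝ≥0∞}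
    {L : E →ₗ[𝕜] Lp F p μ} {k : Ω → ℝ} (hL : ∀ a, ∀ᵐ ω ∂μ, ‖L a ω‖ ≤ k ω * ‖a‖)
    {ι : Type*} [Countable ι] (d : ι → E) :
    ∀ᵐ ω ∂μ, ∀ c : ι →₀ 𝕜, ‖Finsupp.linearCombination 𝕜 (fun i => L (d i) ω) c‖ ≤
      k ω * ‖Finsupp.linearCombination 𝕜 d c‖ := by
  have hsum (t : Finset ι) : ∀ᵐ ω ∂μ, ∀ c : ι → 𝕜,
      ‖∑ i ∈ t, c i • L (d i) ω‖ ≤ k ω * ‖∑ i ∈ t, c i • d i‖ := by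
    refine ae_forall_of_isClosed (fun ω => isClosed_le (by fun_prop) (by fun_prop)) fun c => ?_
    filter_upwards [hL (∑ i ∈ t, c i • d i), Lp.coeFn_fun_finsetSum t fun i => c i • L (d i),
      (ae_ball_iff t.countable_toSet).2 fun i _ => Lp.coeFn_smul (c i) (L (d i))]
      with ω hle hadd hsmul
    rw [map_sum] at hle
    simp only [map_smul] at hle
    rwa [hadd, Finset.sum_congr rfl hsmul] at hle
  filter_upwards [ae_all_iff.2 hsum] with ω hω c
  exact hω c.support c

theorem exists_measurableField_of_ae_norm_le [TopologicalSpace.SeparableSpace E]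
    [CompleteSpace F] {p : ℝ≥0∞} {L : E →ₗ[𝕜] Lp F p μ} {k : Ω → ℝ}
    (hL : ∀ a, ∀ᵐ ω ∂μ, ‖L a ω‖ ≤ k ω * ‖a‖) :
    ∃ A : Ω → E →L[𝕜] F, IsMeasurableField A ∧ ∀ a, ∀ᵐ ω ∂μ, A ω a = L a ω := by
  let d := TopologicalSpace.denseSeq E
  let e : (ℕ →₀ 𝕜) →ₗ[𝕜] E := Finsupp.linearCombination 𝕜 d
  have hed (n : ℕ) : e (Finsupp.single n 1) = d n := by simp [e]
  have he : DenseRange e := (TopologicalSpace.denseRange_denseSeq E).mono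
    (Set.range_subset_iff.2 fun n => ⟨_, hed n⟩)
  let f (ω : Ω) : (ℕ →₀ 𝕜) →ₗ[𝕜] F := Finsupp.linearCombination 𝕜 fun n => L (d n) ω
  obtain ⟨S, hSae, hS, hSf⟩ := (ae_forall_norm_linearCombination_le hL d).exists_measurable_mem
  let A : Ω → E →L[𝕜] F := S.indicator fun ω => (f ω).extendOfNorm e
  have hA (ω : Ω) (hω : ω ∈ S) (n : ℕ) : A ω (d n) = L (d n) ω := calc
    A ω (d n) = (f ω).extendOfNorm e (e (Finsupp.single n 1)) := by
      rw [hed, show A ω = (f ω).extendOfNorm e from Set.indicator_of_mem hω _]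
    _ = f ω (Finsupp.single n 1) := LinearMap.extendOfNorm_eq he ⟨k ω, hSf ω hω⟩ _
    _ = L (d n) ω := by simp [f]
  refine ⟨A, isMeasurableField_of_denseRange (TopologicalSpace.denseRange_denseSeq E) fun n => ?_,
    fun a => ?_⟩
  · have : (fun ω => A ω (d n)) = S.indicator (L (d n)) := by
      ext ω
      by_cases hω : ω ∈ S
      · rw [hA ω hω, Set.indicator_of_mem hω]
      · simp [A, hω]
    exact this ▸ (Lp.stronglyMeasurable _).indicator hS
  · have hdist : ∀ᵐ ω ∂μ, ∀ n, ‖L a ω - L (d n) ω‖ ≤ k ω * ‖a - d n‖ := by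
      refine ae_all_iff.2 fun n => ?_
      filter_upwards [hL (a - d n), Lp.coeFn_sub (L a) (L (d n))] with ω hle hsub
      rwa [map_sub, hsub] at hle
    filter_upwards [hSae, hdist] with ω hω hle
    have hle' (x : E) : ‖L a ω - A ω x‖ ≤ k ω * ‖a - x‖ :=
      (TopologicalSpace.denseRange_denseSeq E).induction_on x
        (isClosed_le (by fun_prop) (by fun_prop)) fun n => by simpa only [← hA ω hω] using hle n
    exact (sub_eq_zero.1 (norm_le_zero_iff.1 (by simpa using hle' a))).symm

end OperatorFields

section DecomposableOperators

variable {Ω : Type*} [MeasurableSpace Ω] {μ : Measure Ω} {p : ℝ≥0∞}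
  {𝕜 E F : Type*} [RCLike 𝕜] [NormedAddCommGroup E] [NormedSpace 𝕜 E]
  [NormedAddCommGroup F] [NormedSpace 𝕜 F]

theorem exists_Lp_ae_ne_zero (𝕜 : Type*) [RCLike 𝕜] (μ : Measure Ω) [SigmaFinite μ]
    (hp0 : p ≠ 0) (hp : p ≠ ∞) : ∃ h : Lp 𝕜 p μ, ∀ᵐ ω ∂μ, h ω ≠ 0 := by
  have hp' : 0 < p.toReal := ENNReal.toReal_pos hp0 hp
  obtain ⟨g, hg0, hg, hlt⟩ := exists_pos_lintegral_lt_of_sigmaFinite μ one_ne_zero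
  let f (ω : Ω) : 𝕜 := ((g ω : ℝ) ^ p.toReal⁻¹ : ℝ)
  have hf : MemLp f p μ := by
    refine ⟨by fun_prop, ?_⟩
    rw [eLpNorm_lt_top_iff_lintegral_rpow_enorm_lt_top hp0 hp]
    refine lt_of_eq_of_lt (lintegral_congr fun ω => ?_) (hlt.trans ENNReal.one_lt_top)
    rw [← ofReal_norm, RCLike.norm_ofReal, abs_of_nonneg (by positivity),
      ENNReal.ofReal_rpow_of_nonneg (by positivity) hp'.le,
      Real.rpow_inv_rpow (by positivity) hp'.ne', ENNReal.ofReal_coe_nnreal]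
  refine ⟨hf.toLp f, ?_⟩
  filter_upwards [hf.coeFn_toLp] with ω hω
  rw [hω]
  exact RCLike.ofReal_ne_zero.2 (Real.rpow_pos_of_pos (hg0 ω) _).ne'

theorem ae_enorm_le_of_eLpNorm_restrict_le [SigmaFinite μ] (hp0 : p ≠ 0) (hp : p ≠ ∞) {f : Ω → E}
    {g : Ω → F} (hf : AEStronglyMeasurable f μ)
    (h : ∀ s, MeasurableSet s → μ s < ∞ →
      eLpNorm f p (μ.restrict s) ≤ eLpNorm g p (μ.restrict s)) :
    ∀ᵐ ω ∂μ, ‖f ω‖ₑ ≤ ‖g ω‖ₑ := by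
  have hp' : 0 < p.toReal := ENNReal.toReal_pos hp0 hp
  have hle := ae_le_of_forall_setLIntegral_le_of_sigmaFinite₀ (hf.enorm.pow_const p.toReal)
    (g := fun ω => ‖g ω‖ₑ ^ p.toReal) fun s hs hμs => by
      simpa only [eLpNorm_eq_lintegral_rpow_enorm_toReal hp0 hp,
        ENNReal.rpow_le_rpow_iff (one_div_pos.2 hp')] using h s hs hμs
  filter_upwards [hle] with ω hω
  exact (ENNReal.rpow_le_rpow_iff hp').1 hω

/-- The linear map `a ↦ h a` embedding `E` into `Lᵖ(Ω, E)` by means of a scalar function `h`,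
which stands in for the constant functions when `μ` is infinite. -/
noncomputable def smulConst (h : Lp 𝕜 p μ) : E →ₗ[𝕜] Lp E p μ where
  toFun a := (ContinuousLinearMap.toSpanSingleton 𝕜 a).compLp h
  map_add' a b := by
    rw [ContinuousLinearMap.toSpanSingleton_add, ContinuousLinearMap.add_compLp]
  map_smul' c a := by
    rw [ContinuousLinearMap.toSpanSingleton_smul, ContinuousLinearMap.smul_compLp,
      RingHom.id_apply]

theorem coeFn_smulConst (h : Lp 𝕜 p μ) (a : E) : ∀ᵐ ω ∂μ, smulConst h a ω = h ω • a :=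
  ContinuousLinearMap.coeFn_compLp _ h

variable [Fact (1 ≤ p)]

/-- The operator `T` commutes with multiplication by the functions in `D`. -/
def CommutesWithMul (D : Set (Lp 𝕜 ∞ μ)) (T : Lp E p μ →L[𝕜] Lp F p μ) : Prop :=
  ∀ g ∈ D, ∀ φ : Lp E p μ, T (g • φ : Lp E p μ) = (g • T φ : Lp F p μ)

/-- `T` is the decomposable operator with fibres `A ω`, that is `T = ∫^⊕ A ω dμ(ω)`. -/
def IsDecomposedBy (T : Lp E p μ →L[𝕜] Lp F p μ) (A : Ω → E →L[𝕜] F) : Prop :=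
  ∀ φ, ∀ᵐ ω ∂μ, T φ ω = A ω (φ ω)

theorem enorm_indicator_smul {s : Set Ω} (hs : MeasurableSet s) (hμs : μ s ≠ ∞) (φ : Lp E p μ) :
    ‖(indicatorConstLp ∞ hs hμs (1 : 𝕜) • φ : Lp E p μ)‖ₑ = eLpNorm φ p (μ.restrict s) := by
  rw [Lp.enorm_def, ← eLpNorm_indicator_eq_eLpNorm_restrict hs]
  refine eLpNorm_congr_ae ?_
  filter_upwards [Lp.coeFn_lpSMul (r := p) (indicatorConstLp ∞ hs hμs (1 : 𝕜)) φ,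
    indicatorConstLp_coeFn (p := ∞) (hs := hs) (hμs := hμs) (c := (1 : 𝕜))] with ω hsmul hind
  rw [hsmul, Pi.smul_apply', hind]
  by_cases hω : ω ∈ s <;> simp [hω]

theorem CommutesWithMul.ae_norm_apply_le [SigmaFinite μ] (hp : p ≠ ∞)
    {T : Lp E p μ →L[𝕜] Lp F p μ} (hT : CommutesWithMul Set.univ T) (φ : Lp E p μ) :
    ∀ᵐ ω ∂μ, ‖T φ ω‖ ≤ ‖T‖ * ‖φ ω‖ := by
  have hle : ∀ᵐ ω ∂μ, ‖T φ ω‖ₑ ≤ ‖((‖T‖ : 𝕜) • φ ω)‖ₑ := by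
    refine ae_enorm_le_of_eLpNorm_restrict_le (zero_lt_one.trans_le Fact.out).ne' hp
      (Lp.aestronglyMeasurable (T φ)) fun s hs hμs => ?_
    calc eLpNorm (T φ) p (μ.restrict s)
        = ‖T (indicatorConstLp ∞ hs hμs.ne (1 : 𝕜) • φ : Lp E p μ)‖ₑ := by
          rw [hT _ trivial, enorm_indicator_smul]
      _ ≤ ‖T‖ₑ * eLpNorm φ p (μ.restrict s) := by
          rw [← enorm_indicator_smul (𝕜 := 𝕜) hs hμs.ne]
          exact T.le_opENorm _
      _ = eLpNorm ((‖T‖ : 𝕜) • ⇑φ) p (μ.restrict s) := by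
          rw [eLpNorm_const_smul, show ‖(‖T‖ : 𝕜)‖ₑ = ‖T‖ₑ by simp [enorm_eq_iff_norm_eq]]
  filter_upwards [hle] with ω hω
  simpa [enorm_le_iff_norm_le, norm_smul] using hω

theorem CommutesWithMul.exists_isDecomposedBy [SigmaFinite μ] [TopologicalSpace.SeparableSpace E]
    [CompleteSpace F] (hp : p ≠ ∞) {T : Lp E p μ →L[𝕜] Lp F p μ}
    (hT : CommutesWithMul Set.univ T) :
    ∃ A : Ω → E →L[𝕜] F, IsMeasurableField A ∧ IsDecomposedBy T A := by
  obtain ⟨h, hh⟩ := exists_Lp_ae_ne_zero 𝕜 μ (zero_lt_one.trans_le Fact.out).ne' hp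
  obtain ⟨B, hB, hTB⟩ := exists_measurableField_of_ae_norm_le
    (L := T.toLinearMap ∘ₗ smulConst h) (k := fun ω => ‖T‖ * ‖h ω‖) fun a => by
      filter_upwards [hT.ae_norm_apply_le hp (smulConst h a), coeFn_smulConst h a] with ω hle hω
      rwa [hω, norm_smul, ← mul_assoc] at hle
  refine ⟨fun ω => (h ω)⁻¹ • B ω, fun a => (Lp.stronglyMeasurable h).inv₀.smul (hB a), fun φ => ?_⟩
  -- A.e. the pointwise bound for `φ - h a` holds for all `a`; take `a = h(ω)⁻¹ φ(ω)`.
  have hdist : ∀ᵐ ω ∂μ, ∀ a, ‖T φ ω - B ω a‖ ≤ ‖T‖ * ‖φ ω - h ω • a‖ := by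
    refine ae_forall_of_isClosed (fun ω => isClosed_le (by fun_prop) (by fun_prop)) fun a => ?_
    filter_upwards [hT.ae_norm_apply_le hp (φ - smulConst h a), hTB a, coeFn_smulConst h a,
      Lp.coeFn_sub (T φ) (T (smulConst h a)), Lp.coeFn_sub φ (smulConst h a)]
      with ω hle hBω hω hsub hsub'
    rw [map_sub, hsub, hsub', Pi.sub_apply, Pi.sub_apply, hω] at hle
    rwa [hBω]
  filter_upwards [hdist, hh] with ω hle hne
  have := hle ((h ω)⁻¹ • φ ω)
  rw [smul_inv_smul₀ hne, sub_self, norm_zero, mul_zero, norm_le_zero_iff, sub_eq_zero] at this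
  rw [this, map_smul, smul_apply]

namespace IsDecomposedBy

variable {T T' : Lp E p μ →L[𝕜] Lp F p μ} {A A' : Ω → E →L[𝕜] F}

theorem congr_ae (hT : IsDecomposedBy T A) (h : ∀ᵐ ω ∂μ, A ω = A' ω) : IsDecomposedBy T A' :=
  fun φ => by
    filter_upwards [hT φ, h] with ω hω hAA'
    rw [hω, hAA']

theorem comp {G : Type*} [NormedAddCommGroup G] [NormedSpace 𝕜 G]
    {S : Lp F p μ →L[𝕜] Lp G p μ} {B : Ω → F →L[𝕜] G} (hS : IsDecomposedBy S B)
    (hT : IsDecomposedBy T A) : IsDecomposedBy (S.comp T) fun ω => (B ω).comp (A ω) := fun φ => by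
  filter_upwards [hS (T φ), hT φ] with ω hω hω'
  rw [ContinuousLinearMap.comp_apply, hω, hω', ContinuousLinearMap.comp_apply]

theorem commutesWithMul (hT : IsDecomposedBy T A) (D : Set (Lp 𝕜 ∞ μ)) : CommutesWithMul D T :=
  fun g _ φ => by
    refine Lp.ext ?_
    filter_upwards [hT φ, hT (g • φ), Lp.coeFn_lpSMul (r := p) g φ,
      Lp.coeFn_lpSMul (r := p) g (T φ)] with ω hφ hgφ hsmul hsmul'
    rw [hgφ, hsmul, hsmul', Pi.smul_apply', Pi.smul_apply', hφ, map_smul]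

theorem enorm_le_essSup (hT : IsDecomposedBy T A) : ‖T‖ₑ ≤ essSup (fun ω => ‖A ω‖ₑ) μ :=
  T.opENorm_le_bound fun φ => by
    rw [Lp.enorm_def, Lp.enorm_def, eLpNorm_congr_ae (hT φ)]
    simpa [eLpNormEssSup] using eLpNorm_le_eLpNorm_top_mul_eLpNorm p A (Lp.aestronglyMeasurable φ)
      (fun B a => B a) 1 (ae_of_all _ fun ω => by simpa using (A ω).le_opNNNorm (φ ω))

variable [SigmaFinite μ] [TopologicalSpace.SeparableSpace E]

theorem ae_eq (hp : p ≠ ∞) (hA : IsDecomposedBy T A) (hA' : IsDecomposedBy T A') :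
    ∀ᵐ ω ∂μ, A ω = A' ω := by
  obtain ⟨h, hh⟩ := exists_Lp_ae_ne_zero 𝕜 μ (zero_lt_one.trans_le Fact.out).ne' hp
  have heq : ∀ᵐ ω ∂μ, ∀ a, A ω (h ω • a) = A' ω (h ω • a) := by
    refine ae_forall_of_isClosed (fun ω => isClosed_eq (by fun_prop) (by fun_prop)) fun a => ?_
    filter_upwards [hA (smulConst h a), hA' (smulConst h a), coeFn_smulConst h a]
      with ω hω hω' hsmul
    rw [← hsmul, ← hω, hω']
  filter_upwards [heq, hh] with ω hω hne
  ext a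
  simpa [hne] using hω a

theorem eq_iff (hp : p ≠ ∞) (hA : IsDecomposedBy T A) (hA' : IsDecomposedBy T' A') :
    T = T' ↔ ∀ᵐ ω ∂μ, A ω = A' ω := by
  refine ⟨fun h => hA.ae_eq hp (h ▸ hA'), fun h => ContinuousLinearMap.ext fun φ => Lp.ext ?_⟩
  filter_upwards [hA φ, hA' φ, h] with ω hω hω' heq
  rw [hω, hω', heq]

theorem ae_norm_le (hp : p ≠ ∞) (hT : IsDecomposedBy T A) : ∀ᵐ ω ∂μ, ‖A ω‖ ≤ ‖T‖ := by
  obtain ⟨h, hh⟩ := exists_Lp_ae_ne_zero 𝕜 μ (zero_lt_one.trans_le Fact.out).ne' hp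
  have hle : ∀ᵐ ω ∂μ, ∀ a, ‖A ω (h ω • a)‖ ≤ ‖T‖ * ‖h ω • a‖ := by
    refine ae_forall_of_isClosed (fun ω => isClosed_le (by fun_prop) (by fun_prop)) fun a => ?_
    filter_upwards [hT (smulConst h a), coeFn_smulConst h a,
      (hT.commutesWithMul Set.univ).ae_norm_apply_le hp (smulConst h a)] with ω hω hsmul hle
    rwa [hω, hsmul] at hle
  filter_upwards [hle, hh] with ω hω hne
  refine (A ω).opNorm_le_bound (norm_nonneg T) fun a => ?_
  simpa [smul_inv_smul₀ hne] using hω ((h ω)⁻¹ • a)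

theorem enorm_eq_essSup (hp : p ≠ ∞) (hT : IsDecomposedBy T A) :
    ‖T‖ₑ = essSup (fun ω => ‖A ω‖ₑ) μ := by
  refine le_antisymm hT.enorm_le_essSup (essSup_le_of_ae_le _ ?_)
  filter_upwards [hT.ae_norm_le hp] with ω hω
  exact enorm_le_iff_norm_le.2 hω

end IsDecomposedBy

theorem IsMeasurableField.exists_isDecomposedBy [TopologicalSpace.SeparableSpace E]
    {A : Ω → E →L[𝕜] F} (hA : IsMeasurableField A) (hbdd : essSup (fun ω => ‖A ω‖ₑ) μ < ∞) :
    ∃ T : Lp E p μ →L[𝕜] Lp F p μ, IsDecomposedBy T A := by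
  set C : ℝ := (essSup (fun ω => ‖A ω‖ₑ) μ).toReal
  have hle (φ : Lp E p μ) : ∀ᵐ ω ∂μ, ‖A ω (φ ω)‖ ≤ C * ‖φ ω‖ := by
    filter_upwards [ENNReal.ae_le_essSup fun ω => ‖A ω‖ₑ] with ω hω
    rw [← ofReal_norm, ENNReal.ofReal_le_iff_le_toReal hbdd.ne] at hω
    exact (A ω).le_of_opNorm_le hω _
  have hmem (φ : Lp E p μ) : MemLp (fun ω => A ω (φ ω)) p μ :=
    (Lp.memLp φ).of_le_mul
      (hA.stronglyMeasurable_apply (Lp.stronglyMeasurable φ)).aestronglyMeasurable (hle φ)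
  let T : Lp E p μ →ₗ[𝕜] Lp F p μ :=
    { toFun φ := (hmem φ).toLp _
      map_add' φ ψ := by
        rw [← MemLp.toLp_add, MemLp.toLp_eq_toLp_iff]
        filter_upwards [Lp.coeFn_add φ ψ] with ω hω
        rw [hω, Pi.add_apply, Pi.add_apply, map_add]
      map_smul' c φ := by
        rw [RingHom.id_apply, ← MemLp.toLp_const_smul, MemLp.toLp_eq_toLp_iff]
        filter_upwards [Lp.coeFn_smul c φ] with ω hω
        rw [hω, Pi.smul_apply, Pi.smul_apply, map_smul] }
  refine ⟨T.mkContinuous C fun φ => Lp.norm_le_mul_norm_of_ae_le_mul ?_,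
    fun φ => (hmem φ).coeFn_toLp⟩
  filter_upwards [(hmem φ).coeFn_toLp, hle φ] with ω hω hle
  rwa [show T φ ω = A ω (φ ω) from hω]

end DecomposableOperators

section ZeroExtend

variable {𝕜 E F : Type*} [RCLike 𝕜] [NormedAddCommGroup E] [InnerProductSpace 𝕜 E]
  [NormedAddCommGroup F] [NormedSpace 𝕜 F] {K : Submodule 𝕜 E} [K.HasOrthogonalProjection]

/-- The extension by zero on `Kᗮ` of an operator defined on `K`, that is `f P_K`. It turns
operators defined on varying subspaces into operators on one and the same space. -/
noncomputable def zeroExtend (f : K →L[𝕜] F) : E →L[𝕜] F :=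
  f.comp K.orthogonalProjectionOnto

theorem zeroExtend_apply (f : K →L[𝕜] F) (x : E) :
    zeroExtend f x = f (K.orthogonalProjectionOnto x) :=
  rfl

theorem zeroExtend_coe (f : K →L[𝕜] F) (x : K) : zeroExtend f x = f x := by
  rw [zeroExtend_apply, Submodule.orthogonalProjectionOnto_mem_subspace_eq_self]

theorem zeroExtend_injective : Function.Injective (zeroExtend (F := F) (K := K)) :=
  fun f g h => by
    ext x
    rw [← zeroExtend_coe f, h, zeroExtend_coe]

theorem norm_zeroExtend (f : K →L[𝕜] F) : ‖zeroExtend f‖ = ‖f‖ := by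
  refine le_antisymm ?_ (f.opNorm_le_bound (norm_nonneg _) fun x => ?_)
  · refine (zeroExtend f).opNorm_le_bound (norm_nonneg f) fun x => ?_
    exact f.le_opNorm_of_le (K.norm_orthogonalProjectionOnto_apply_le x)
  · rw [← zeroExtend_coe]
    exact (zeroExtend f).le_opNorm x

theorem enorm_zeroExtend (f : K →L[𝕜] F) : ‖zeroExtend f‖ₑ = ‖f‖ₑ :=
  enorm_eq_iff_norm_eq.2 (norm_zeroExtend f)

end ZeroExtend

theorem exists_starProjection_eq {𝕜 E : Type*} [RCLike 𝕜] [NormedAddCommGroup E]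
    [InnerProductSpace 𝕜 E] [CompleteSpace E] {P : E →L[𝕜] E} (hP : IsIdempotentElem P)
    (hle : ‖P‖ ≤ 1) : ∃ K : ClosedSubmodule 𝕜 E, K.toSubmodule.starProjection = P := by
  have hker : P.ker.HasOrthogonalProjection :=
    have := P.isClosed_ker.completeSpace_coe
    inferInstance
  -- For `x ⊥ ker P`, Pythagoras gives `‖P x‖² = ‖P x - x‖² + ‖x‖²`, and `‖P x‖ ≤ ‖x‖`.
  have hfix : ∀ x ∈ P.kerᗮ, P x = x := fun x hx => by
    have hPx : P x - x ∈ P.ker := by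
      simpa [sub_eq_zero] using DFunLike.congr_fun hP x
    have hpyth := norm_add_sq_eq_norm_sq_add_norm_sq_of_inner_eq_zero _ _ (hx _ hPx)
    have hcontr : ‖P x‖ ≤ ‖x‖ := by simpa using P.le_of_opNorm_le hle x
    rw [sub_add_cancel] at hpyth
    have : ‖P x - x‖ * ‖P x - x‖ ≤ 0 := by
      linarith [mul_self_le_mul_self (norm_nonneg (P x)) hcontr]
    exact sub_eq_zero.1 (norm_eq_zero.1 (mul_self_eq_zero.1 (this.antisymm (mul_self_nonneg _))))
  refine ⟨⟨P.kerᗮ, P.ker.isClosed_orthogonal⟩, ContinuousLinearMap.ext fun a => ?_⟩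
  calc P.kerᗮ.starProjection a = P (P.ker.starProjection a + P.kerᗮ.starProjection a) := by
        rw [map_add, show P (P.ker.starProjection a) = 0 from P.ker.starProjection_apply_mem a,
          zero_add, hfix _ (P.kerᗮ.starProjection_apply_mem a)]
    _ = P a := by rw [P.ker.starProjection_add_starProjection_orthogonal]

section WeakMeasurability

variable {Ω 𝕜 E : Type*} [MeasurableSpace Ω] [RCLike 𝕜] [NormedAddCommGroup E]
  [InnerProductSpace 𝕜 E] [CompleteSpace E] [TopologicalSpace.SeparableSpace E]

theorem stronglyMeasurable_of_inner {f : Ω → E}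
    (hf : ∀ b : E, Measurable fun ω => inner 𝕜 b (f ω)) : StronglyMeasurable f := by
  borelize E
  let Φ (x : E) (n : ℕ) : 𝕜 := inner 𝕜 (TopologicalSpace.denseSeq E n) x
  have hinj : Function.Injective Φ := fun x y hxy => ext_inner_left 𝕜 fun b => by
    have : (fun b : E => inner 𝕜 b x) = fun b => inner 𝕜 b y :=
      (TopologicalSpace.denseRange_denseSeq E).equalizer (by fun_prop) (by fun_prop) hxy
    exact congrFun this b
  -- An injective continuous map between Polish spaces is a measurable embedding.
  have hΦ : MeasurableEmbedding Φ := Continuous.measurableEmbedding (by fun_prop) hinj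
  exact (hΦ.measurable_comp_iff.1 (measurable_pi_lambda _ fun n => hf _)).stronglyMeasurable

theorem isMeasurableField_iff_inner {F : Type*} [NormedAddCommGroup F] [NormedSpace 𝕜 F]
    {A : Ω → F →L[𝕜] E} :
    IsMeasurableField A ↔ ∀ a b, Measurable fun ω => inner 𝕜 b (A ω a) :=
  ⟨fun hA a _ => (stronglyMeasurable_const.inner (hA a)).measurable,
    fun hA a => stronglyMeasurable_of_inner (hA a)⟩

end WeakMeasurability

section MultiplicativeInvariance

variable {Ω H : Type*} [MeasurableSpace Ω] {μ : Measure Ω}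
  [NormedAddCommGroup H] [InnerProductSpace ℂ H]

theorem IsDetermining.ae_eq_zero {D : Set (Lp ℂ ∞ μ)} (hD : IsDetermining D) {f : Ω → ℂ}
    (hf : Integrable f μ) (h : ∀ g ∈ D, ∫ ω, f ω * g ω ∂μ = 0) : f =ᵐ[μ] 0 := by
  have hcoe := hf.coeFn_toL1
  rw [hD (hf.toL1 f) fun g hg => (integral_congr_ae (hcoe.mul .rfl)).trans (h g hg)] at hcoe
  exact hcoe.symm.trans (Lp.coeFn_zero ℂ 1 μ)

theorem inner_smul_eq_integral (g : Lp ℂ ∞ μ) (φ ψ : Lp H 2 μ) :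
    inner ℂ ψ (g • φ : Lp H 2 μ) = ∫ ω, inner ℂ (ψ ω) (φ ω) * g ω ∂μ := by
  rw [L2.inner_def]
  refine integral_congr_ae ?_
  filter_upwards [Lp.coeFn_lpSMul (r := 2) g φ] with ω hω
  rw [hω, Pi.smul_apply', inner_smul_right, mul_comm]

theorem inner_smul_eq_zero_of_ae {φ ψ : Lp H 2 μ} (h : ∀ᵐ ω ∂μ, inner ℂ (ψ ω) (φ ω) = 0)
    (g : Lp ℂ ∞ μ) : inner ℂ ψ (g • φ : Lp H 2 μ) = 0 := by
  rw [inner_smul_eq_integral]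
  refine integral_eq_zero_of_ae ?_
  filter_upwards [h] with ω hω
  rw [hω, zero_mul, Pi.zero_apply]

theorem IsMulInvariant.ae_inner_eq_zero {D : Set (Lp ℂ ∞ μ)} {W : ClosedSubmodule ℂ (Lp H 2 μ)}
    (hW : IsMulInvariant D W) (hD : IsDetermining D) {φ χ : Lp H 2 μ} (hφ : φ ∈ W.toSubmodule)
    (hχ : χ ∈ W.toSubmoduleᗮ) : ∀ᵐ ω ∂μ, inner ℂ (χ ω) (φ ω) = 0 :=
  hD.ae_eq_zero (L2.integrable_inner χ φ) fun g hg => by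
    rw [← inner_smul_eq_integral]
    exact Submodule.inner_left_of_mem_orthogonal (hW φ hφ g hg) hχ

variable [CompleteSpace H]

theorem IsMulInvariant.univ {D : Set (Lp ℂ ∞ μ)} {W : ClosedSubmodule ℂ (Lp H 2 μ)}
    (hW : IsMulInvariant D W) (hD : IsDetermining D) : IsMulInvariant Set.univ W :=
  fun φ hφ g _ => by
    rw [← W.toSubmodule.orthogonal_orthogonal]
    exact fun χ hχ => inner_smul_eq_zero_of_ae (hW.ae_inner_eq_zero hD hφ hχ) g

theorem IsMulInvariant.commutesWithMul_starProjection {D : Set (Lp ℂ ∞ μ)}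
    {W : ClosedSubmodule ℂ (Lp H 2 μ)} (hW : IsMulInvariant D W) (hD : IsDetermining D) :
    CommutesWithMul Set.univ W.toSubmodule.starProjection := fun g _ φ => by
  refine Submodule.eq_starProjection_of_mem_orthogonal
    (hW.univ hD _ (Submodule.starProjection_apply_mem _ φ) g trivial) ?_
  rw [sub_eq_add_neg, ← Lp.smul_neg, ← Lp.add_smul, ← sub_eq_add_neg]
  refine fun ψ hψ => inner_smul_eq_zero_of_ae ?_ g
  filter_upwards [hW.ae_inner_eq_zero hD hψ (W.toSubmodule.sub_starProjection_mem_orthogonal φ)]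
    with ω hω
  exact inner_eq_zero_symm.1 hω

variable {W : ClosedSubmodule ℂ (Lp H 2 μ)} {U : W.toSubmodule →L[ℂ] Lp H 2 μ}

theorem isMulPreserving_iff {D : Set (Lp ℂ ∞ μ)} (hW : IsMulInvariant D W)
    (hP : CommutesWithMul D W.toSubmodule.starProjection) :
    IsMulPreserving D U ↔ CommutesWithMul D (zeroExtend U) := by
  refine ⟨fun ⟨_, hU⟩ g hg φ => ?_, fun hU => ⟨hW, fun g hg φ => ?_⟩⟩
  · rw [zeroExtend_apply, zeroExtend_apply, ← hU g hg]
    congr 1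
    exact Subtype.ext (hP g hg φ)
  · rw [← zeroExtend_coe, hU g hg, zeroExtend_coe]

end MultiplicativeInvariance

section Commutation

variable {Ω E F : Type*} [MeasurableSpace Ω] {μ : Measure Ω}
  [NormedAddCommGroup E] [InnerProductSpace ℂ E] [CompleteSpace E]
  [NormedAddCommGroup F] [InnerProductSpace ℂ F] [CompleteSpace F]

theorem inner_map_smul_sub_inner_smul_map (T : Lp E 2 μ →L[ℂ] Lp F 2 μ) (g : Lp ℂ ∞ μ)
    (φ : Lp E 2 μ) (χ : Lp F 2 μ) :
    inner ℂ χ (T (g • φ : Lp E 2 μ)) - inner ℂ χ (g • T φ : Lp F 2 μ) =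
      ∫ ω, (inner ℂ (T.adjoint χ ω) (φ ω) - inner ℂ (χ ω) (T φ ω)) * g ω ∂μ := by
  rw [← T.adjoint_inner_left, inner_smul_eq_integral, inner_smul_eq_integral, ← integral_sub]
  · simp only [sub_mul]
  · exact (L2.integrable_inner _ _).mul_of_top_left (Lp.memLp g)
  · exact (L2.integrable_inner _ _).mul_of_top_left (Lp.memLp g)

theorem CommutesWithMul.univ {D : Set (Lp ℂ ∞ μ)} {T : Lp E 2 μ →L[ℂ] Lp F 2 μ}
    (hT : CommutesWithMul D T) (hD : IsDetermining D) : CommutesWithMul Set.univ T :=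
  fun g _ φ => ext_inner_left ℂ fun χ => by
    have hzero := hD.ae_eq_zero
      ((L2.integrable_inner (T.adjoint χ) φ).sub (L2.integrable_inner χ (T φ))) fun g hg =>
        (inner_map_smul_sub_inner_smul_map T g φ χ).symm.trans (by rw [hT g hg φ, sub_self])
    rw [← sub_eq_zero, inner_map_smul_sub_inner_smul_map]
    refine integral_eq_zero_of_ae ?_
    filter_upwards [hzero] with ω hω
    simp only [Pi.sub_apply, Pi.zero_apply] at hω
    rw [hω, zero_mul, Pi.zero_apply]

end Commutation

section RangeFunctions

variable {Ω H : Type*} [MeasurableSpace Ω] {μ : Measure Ω}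
  [NormedAddCommGroup H] [InnerProductSpace ℂ H] [CompleteSpace H]
  {W : ClosedSubmodule ℂ (Lp H 2 μ)} {J : Ω → ClosedSubmodule ℂ H}

theorem isGivenBy_iff {U : W.toSubmodule →L[ℂ] Lp H 2 μ} {R : RangeOperator J}
    (hP : IsDecomposedBy W.toSubmodule.starProjection fun ω => (J ω).toSubmodule.starProjection) :
    IsGivenBy U R ↔ IsDecomposedBy (zeroExtend U) fun ω => zeroExtend (R ω) := by
  refine ⟨fun hU φ => ?_, fun hU φ => ?_⟩
  · filter_upwards [hU (W.toSubmodule.orthogonalProjectionOnto φ), hP φ] with ω ⟨_, hω⟩ hPω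
    rw [zeroExtend_apply, hω, zeroExtend_apply]
    congr 1
    exact Subtype.ext hPω
  · filter_upwards [hU φ, hP φ] with ω hω hPω
    rw [Submodule.starProjection_eq_self_iff.2 φ.2, eq_comm,
      Submodule.starProjection_eq_self_iff] at hPω
    rw [zeroExtend_coe] at hω
    exact ⟨hPω, hω.trans (zeroExtend_coe (R ω) ⟨_, hPω⟩)⟩

theorem IsDecomposedBy.isRangeFunctionOf
    (hP : IsDecomposedBy W.toSubmodule.starProjection fun ω => (J ω).toSubmodule.starProjection) :
    IsRangeFunctionOf J W := fun φ => by
  rw [← Submodule.starProjection_eq_self_iff, Lp.ext_iff]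
  refine eventually_congr ?_
  filter_upwards [hP φ] with ω hω
  rw [hω, Submodule.starProjection_eq_self_iff]

variable [TopologicalSpace.SeparableSpace H]

theorem isMeasurableRangeFunction_iff :
    IsMeasurableRangeFunction J ↔ IsMeasurableField fun ω => (J ω).toSubmodule.starProjection :=
  (isMeasurableField_iff_inner (A := fun ω => (J ω).toSubmodule.starProjection)).symm

theorem isMeasurableRangeOperator_iff {R : RangeOperator J} :
    IsMeasurableRangeOperator R ↔ IsMeasurableField fun ω => zeroExtend (R ω) :=
  (isMeasurableField_iff_inner (A := fun ω => zeroExtend (R ω))).symm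

theorem IsRangeFunctionOf.isDecomposedBy (hJW : IsRangeFunctionOf J W)
    (hJ : IsMeasurableRangeFunction J) :
    IsDecomposedBy W.toSubmodule.starProjection fun ω => (J ω).toSubmodule.starProjection := by
  have hbdd : essSup (fun ω => ‖(J ω).toSubmodule.starProjection‖ₑ) μ < ∞ :=
    (essSup_le_of_ae_le 1 (ae_of_all _ fun ω => by
      rw [← ofReal_norm, ENNReal.ofReal_le_one]
      exact (J ω).toSubmodule.starProjection_norm_le)).trans_lt ENNReal.one_lt_top
  obtain ⟨Q, hQ⟩ := (isMeasurableRangeFunction_iff.1 hJ).exists_isDecomposedBy (p := 2) hbdd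
  suffices W.toSubmodule.starProjection = Q from this ▸ hQ
  ext1 φ
  refine (Submodule.eq_starProjection_of_mem_orthogonal ((hJW _).2 ?_) fun ψ hψ => ?_)
  · filter_upwards [hQ φ] with ω hω
    exact hω ▸ Submodule.starProjection_apply_mem _ _
  · rw [L2.inner_def]
    refine integral_eq_zero_of_ae ?_
    filter_upwards [hQ φ, (hJW ψ).1 hψ, Lp.coeFn_sub φ (Q φ)] with ω hω hψω hsub
    rw [hsub, Pi.sub_apply, hω]
    exact Submodule.sub_starProjection_mem_orthogonal _ _ hψω

theorem IsMulInvariant.exists_isRangeFunctionOf [SigmaFinite μ] {D : Set (Lp ℂ ∞ μ)}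
    (hW : IsMulInvariant D W) (hD : IsDetermining D) :
    ∃ J : Ω → ClosedSubmodule ℂ H, IsMeasurableRangeFunction J ∧ IsRangeFunctionOf J W := by
  obtain ⟨A, hAmeas, hA⟩ :=
    (hW.commutesWithMul_starProjection hD).exists_isDecomposedBy ENNReal.ofNat_ne_top
  have hidem : ∀ᵐ ω ∂μ, IsIdempotentElem (A ω) := by
    refine (hA.comp hA).ae_eq ENNReal.ofNat_ne_top ?_
    rwa [← ContinuousLinearMap.mul_def, W.toSubmodule.isIdempotentElem_starProjection.eq]
  obtain ⟨S, hSae, hS, hSA⟩ :=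
    (hidem.and (hA.ae_norm_le ENNReal.ofNat_ne_top)).exists_measurable_mem
  have hproj (ω : Ω) :
      ∃ K : ClosedSubmodule ℂ H, K.toSubmodule.starProjection = S.indicator A ω := by
    by_cases hω : ω ∈ S
    · rw [Set.indicator_of_mem hω]
      exact exists_starProjection_eq (hSA ω hω).1
        ((hSA ω hω).2.trans W.toSubmodule.starProjection_norm_le)
    · exact exists_starProjection_eq (by simp [hω, IsIdempotentElem]) (by simp [hω])
  choose J hJ using hproj
  refine ⟨J, isMeasurableRangeFunction_iff.2 ?_, IsDecomposedBy.isRangeFunctionOf ?_⟩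
  · simpa only [hJ] using hAmeas.indicator hS
  · refine hA.congr_ae ?_
    filter_upwards [hSae] with ω hω
    rw [hJ, Set.indicator_of_mem hω]

theorem exists_isGivenBy_of_essSup_lt_top (hJW : IsRangeFunctionOf J W) {R : RangeOperator J}
    (hR : IsMeasurableRangeOperator R) (hbdd : essSup (fun ω => ‖R ω‖ₑ) μ < ∞) :
    ∃ U : W.toSubmodule →L[ℂ] Lp H 2 μ, IsGivenBy U R := by
  obtain ⟨T, hT⟩ := (isMeasurableRangeOperator_iff.1 hR).exists_isDecomposedBy (p := 2) (μ := μ)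
    (by simpa only [enorm_zeroExtend] using hbdd)
  refine ⟨T.comp W.toSubmodule.subtypeL, fun φ => ?_⟩
  filter_upwards [hT φ, (hJW φ).1 φ.2] with ω hω hφω
  exact ⟨hφω, hω.trans (zeroExtend_coe (R ω) ⟨_, hφω⟩)⟩

end RangeFunctions

section RangeOperators

variable {Ω H : Type*} [MeasurableSpace Ω] {μ : Measure Ω} [SigmaFinite μ]
  [NormedAddCommGroup H] [InnerProductSpace ℂ H] [CompleteSpace H]
  [TopologicalSpace.SeparableSpace H]
  {W : ClosedSubmodule ℂ (Lp H 2 μ)} {J : Ω → ClosedSubmodule ℂ H}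

theorem exists_isGivenBy_of_commutesWithMul (hJ : IsMeasurableRangeFunction J)
    (hJW : IsRangeFunctionOf J W) {U : W.toSubmodule →L[ℂ] Lp H 2 μ}
    (hU : CommutesWithMul Set.univ (zeroExtend U)) :
    ∃ R : RangeOperator J, IsMeasurableRangeOperator R ∧ IsGivenBy U R := by
  obtain ⟨A, hAmeas, hA⟩ := hU.exists_isDecomposedBy ENNReal.ofNat_ne_top
  refine ⟨fun ω => (A ω).comp (J ω).toSubmodule.subtypeL, isMeasurableRangeOperator_iff.2 <|
    hAmeas.comp (isMeasurableRangeFunction_iff.1 hJ), fun φ => ?_⟩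
  filter_upwards [hA φ, (hJW φ).1 φ.2] with ω hω hφω
  rw [zeroExtend_coe] at hω
  exact ⟨hφω, hω⟩

theorem IsGivenBy.eq_iff (hJ : IsMeasurableRangeFunction J)
    (hJW : IsRangeFunctionOf J W) {U U' : W.toSubmodule →L[ℂ] Lp H 2 μ} {R R' : RangeOperator J}
    (hU : IsGivenBy U R) (hU' : IsGivenBy U' R') : U = U' ↔ ∀ᵐ ω ∂μ, R ω = R' ω := by
  have hP := hJW.isDecomposedBy hJ
  rw [isGivenBy_iff hP] at hU hU'
  rw [← zeroExtend_injective.eq_iff, hU.eq_iff ENNReal.ofNat_ne_top hU']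
  simp only [zeroExtend_injective.eq_iff]

theorem IsGivenBy.enorm_eq_essSup (hJ : IsMeasurableRangeFunction J)
    (hJW : IsRangeFunctionOf J W) {U : W.toSubmodule →L[ℂ] Lp H 2 μ} {R : RangeOperator J}
    (hU : IsGivenBy U R) : ‖U‖ₑ = essSup (fun ω => ‖R ω‖ₑ) μ := by
  rw [isGivenBy_iff (hJW.isDecomposedBy hJ)] at hU
  simpa only [enorm_zeroExtend] using hU.enorm_eq_essSup ENNReal.ofNat_ne_top

theorem IsMulInvariant.isMulPreserving_tfae {D : Set (Lp ℂ ∞ μ)} (hW : IsMulInvariant D W)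
    (hD : IsDetermining D) (hJ : IsMeasurableRangeFunction J) (hJW : IsRangeFunctionOf J W)
    (U : W.toSubmodule →L[ℂ] Lp H 2 μ) :
    List.TFAE [IsMulPreserving D U, IsMulPreserving Set.univ U,
      ∃ R : RangeOperator J, IsMeasurableRangeOperator R ∧ IsGivenBy U R] := by
  have hP := hW.commutesWithMul_starProjection hD
  have hiff := isMulPreserving_iff (U := U) hW fun g _ => hP g trivial
  have hiff_univ := isMulPreserving_iff (U := U) (hW.univ hD) hP
  tfae_have 1 → 3 := fun h =>
    exists_isGivenBy_of_commutesWithMul hJ hJW ((hiff.1 h).univ hD)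
  tfae_have 3 → 2 := fun ⟨_, _, hU⟩ =>
    hiff_univ.2 (((isGivenBy_iff (hJW.isDecomposedBy hJ)).1 hU).commutesWithMul Set.univ)
  tfae_have 2 → 1 := fun h => hiff.2 fun g _ => hiff_univ.1 h g trivial
  tfae_finish

end RangeOperators

end MulInvariant

theorem theorem2p2 {Ω H : Type*} [MeasurableSpace Ω] (μ : Measure Ω) [SigmaFinite μ]
    [NormedAddCommGroup H] [InnerProductSpace ℂ H] [CompleteSpace H]
    [TopologicalSpace.SeparableSpace H]
    (D : Set (Lp ℂ ∞ μ)) (hD : MulInvariant.IsDetermining D)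
    (W : ClosedSubmodule ℂ (Lp H 2 μ)) (hW : MulInvariant.IsMulInvariant D W) :
    -- a corresponding measurable range function exists
    (∃ J : Ω → ClosedSubmodule ℂ H,
      MulInvariant.IsMeasurableRangeFunction J ∧ MulInvariant.IsRangeFunctionOf J W) ∧
    ∀ J : Ω → ClosedSubmodule ℂ H,
      MulInvariant.IsMeasurableRangeFunction J → MulInvariant.IsRangeFunctionOf J W →
      -- the three conditions on a bounded operator are equivalent
      (∀ U : W.toSubmodule →L[ℂ] Lp H 2 μ,
        List.TFAE [
          MulInvariant.IsMulPreserving D U,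
          MulInvariant.IsMulPreserving Set.univ U,
          ∃ R : MulInvariant.RangeOperator J,
            MulInvariant.IsMeasurableRangeOperator R ∧ MulInvariant.IsGivenBy U R]) ∧
      -- every essentially bounded measurable range operator arises
      (∀ R : MulInvariant.RangeOperator J, MulInvariant.IsMeasurableRangeOperator R →
        essSup (fun ω => ‖R ω‖ₑ) μ < ∞ →
        ∃ U : W.toSubmodule →L[ℂ] Lp H 2 μ,
          MulInvariant.IsMulPreserving D U ∧ MulInvariant.IsGivenBy U R) ∧
      -- the correspondence is one to one, range operators being identified if equal a.e.
      (∀ (U U' : W.toSubmodule →L[ℂ] Lp H 2 μ) (R R' : MulInvariant.RangeOperator J),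
        MulInvariant.IsMeasurableRangeOperator R → MulInvariant.IsMeasurableRangeOperator R' →
        MulInvariant.IsGivenBy U R → MulInvariant.IsGivenBy U' R' →
        (U = U' ↔ ∀ᵐ ω ∂μ, R ω = R' ω)) ∧
      -- the operator norm is the essential supremum of the norms
      (∀ (U : W.toSubmodule →L[ℂ] Lp H 2 μ) (R : MulInvariant.RangeOperator J),
        MulInvariant.IsMeasurableRangeOperator R → MulInvariant.IsGivenBy U R →
        ‖U‖ₑ = essSup (fun ω => ‖R ω‖ₑ) μ) := by
  refine ⟨hW.exists_isRangeFunctionOf hD, fun J hJ hJW =>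
    ⟨hW.isMulPreserving_tfae hD hJ hJW, fun R hR hbdd => ?_,
      fun _ _ _ _ _ _ hU hU' => hU.eq_iff hJ hJW hU', fun _ _ _ hU => hU.enorm_eq_essSup hJ hJW⟩⟩
  obtain ⟨U, hU⟩ := MulInvariant.exists_isGivenBy_of_essSup_lt_top hJW hR hbdd
  have hiff : MulInvariant.IsMulPreserving D U ↔ ∃ R : MulInvariant.RangeOperator J,
      MulInvariant.IsMeasurableRangeOperator R ∧ MulInvariant.IsGivenBy U R :=
    (hW.isMulPreserving_tfae hD hJ hJW U).out 0 2
  exact ⟨U, hiff.2 ⟨R, hR, hU⟩, hU⟩
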